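/- Let $\mathfrak h$ be a separable infinite-dimensional complex Hilbert space, let $\mathscr G_\bullet(\mathfrak h)$ be the set of all trace-class orthogonal projections of $\mathfrak h$ (operators $P=P^*=P^2$ of finite trace, the null projection included), and let ${}^{\rm w}\mathscr G_\bullet(\mathfrak h)$ be this set with the topology induced by the weak operator topology. Let $\mathbb U(\infty)=\bigcup_{n}\mathbb U(n)$ be the infinite unitary group, i.e. the union of the groups $\mathbb U(n)$ along the inclusions $A\mapsto A\oplus 1$, with the inductive limit topology. Let $B\mathbb U(\infty)$ be any classifying space of $\mathbb U(\infty)$, i.e. the base space of a (locally trivial) principal $\mathbb U(\infty)$-bundle $E\mathbb U(\infty)\to B\mathbb U(\infty)$ whose total space is weakly contractible (nonempty, with $\pi_k(E\mathbb U(\infty))=0$ for all $k\ge 0$). Then ${}^{\rm w}\mathscr G_\bullet(\mathfrak h)$ and $B\mathbb U(\infty)$ have different homotopy type: ${}^{\rm w}\mathscr G_\bullet(\mathfrak h)$ is contractible whereas $B\mathbb U(\infty)$ is not; there is no homotopy equivalence between the two spaces, and no continuous map ${}^{\rm w}\mathscr G_\bullet(\mathfrak h)\to B\mathbb U(\infty)$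 or $B\mathbb U(\infty)\to{}^{\rm w}\mathscr G_\bullet(\mathfrak h)$ is a weak homotopy equivalence (that is, induces bijections on $\pi_k$ for all $k\ge 0$ and all base points). -/

import Mathlib

open scoped Topology unitInterval

universe u v w

noncomputable section

/-! ### Trace-class projections with the weak operator topology -/

/-- A bounded operator `A` on a Hilbert space is trace class if `∑ᵢ ⟪bᵢ, |A| bᵢ⟫ < ∞` for some
(equivalently, for every) Hilbert basis `b`, where `|A| = √(A* A)`. Every Hilbert space has a
Hilbert basis indexed by one of its subsets. -/
def IsTraceClass {H : Type*} [NormedAddCommGroup H] [InnerProductSpace ℂ H] [CompleteSpace H]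
    (A : H →L[ℂ] H) : Prop :=
  ∃ (s : Set H) (b : HilbertBasis s ℂ H),
    Summable fun i : s => (inner ℂ (b i) ((CFC.abs A) (b i))).re

/-- The set of all trace-class orthogonal projections (`P* = P = P²`) of a Hilbert space. -/
def traceClassProjections (H : Type*) [NormedAddCommGroup H] [InnerProductSpace ℂ H]
    [CompleteSpace H] : Set (H →L[ℂ] H) :=
  {P | IsStarProjection P ∧ IsTraceClass P}

/-- The space of all trace-class orthogonal projections, with the topology induced by the weak
operator topology (`H →WOT[ℂ] H` is the space of bounded operators with that topology). -/
abbrev WeakGrassmannian (H : Type*) [NormedAddCommGroup H] [InnerProductSpace ℂ H]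
    [CompleteSpace H] : Type _ :=
  {P : H →WOT[ℂ] H // P.toCLM ∈ traceClassProjections H}

/-! ### The infinite unitary group -/

namespace UnitaryLimit

/-- The infinite matrix which is `A` in the upper left corner and the identity elsewhere. -/
def pad {n : ℕ} (A : Matrix (Fin n) (Fin n) ℂ) (i j : ℕ) : ℂ :=
  if h : i < n ∧ j < n then A ⟨i, h.1⟩ ⟨j, h.2⟩ else if i = j then 1 else 0

/-- The block matrix `A ⊕ 1` of size `m`. -/
def stab {n : ℕ} (m : ℕ) (A : Matrix (Fin n) (Fin n) ℂ) : Matrix (Fin m) (Fin m) ℂ :=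
  Matrix.of fun i j => pad A i j

lemma pad_stab {n m : ℕ} (h : n ≤ m) (A : Matrix (Fin n) (Fin n) ℂ) (i j : ℕ) :
    pad (stab m A) i j = pad A i j := by
  unfold pad stab
  by_cases h1 : i < m ∧ j < m
  · simp [h1, pad]
  · have h2 : ¬ (i < n ∧ j < n) := by omega
    simp [h1, h2]

lemma stab_self {n : ℕ} (A : Matrix (Fin n) (Fin n) ℂ) : stab n A = A := by
  ext i j
  simp [stab, pad]

lemma stab_one {n m : ℕ} : stab m (1 : Matrix (Fin n) (Fin n) ℂ) = 1 := by
  ext i j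
  simp only [stab, pad, Matrix.of_apply, Matrix.one_apply, Fin.ext_iff]
  split_ifs <;> rfl

lemma stab_star {n m : ℕ} (A : Matrix (Fin n) (Fin n) ℂ) : stab m (star A) = star (stab m A) := by
  ext i j
  simp only [stab, pad, Matrix.of_apply, Matrix.star_apply]
  by_cases h : (i : ℕ) < n ∧ (j : ℕ) < n
  · simp [h]
  · have h' : ¬ ((j : ℕ) < n ∧ (i : ℕ) < n) := by omega
    by_cases hij : (i : ℕ) = j
    · by_cases hj : (j : ℕ) < n <;> simp [hij, hj]
    · simp [h, h', hij, Ne.symm hij]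

lemma stab_mul {n m : ℕ} (hnm : n ≤ m) (A B : Matrix (Fin n) (Fin n) ℂ) :
    stab m (A * B) = stab m A * stab m B := by
  ext i j
  obtain ⟨k, rfl⟩ := Nat.exists_eq_add_of_le hnm
  have h1 (x : Fin k) (a : Fin n) : ¬ n + (x : ℕ) = a := by omega
  have h2 (x : Fin k) (a : Fin n) : ¬ (a : ℕ) = n + x := by omega
  simp only [Matrix.mul_apply, stab, Matrix.of_apply]
  rw [Fin.sum_univ_add]
  refine Fin.addCases (fun a => ?_) (fun a => ?_) i <;>
  refine Fin.addCases (fun b => ?_) (fun b => ?_) j <;>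
  simp [pad, Matrix.mul_apply, h1, h2, ← Fin.ext_iff]

/-- The inclusion `U(n) → U(m)`, `A ↦ A ⊕ 1`, for `n ≤ m`. -/
def incl (n m : ℕ) (h : n ≤ m) :
    Matrix.unitaryGroup (Fin n) ℂ →* Matrix.unitaryGroup (Fin m) ℂ where
  toFun A := ⟨stab m A.1, by
    rw [Matrix.mem_unitaryGroup_iff, ← stab_star, ← stab_mul h,
      Matrix.mem_unitaryGroup_iff.1 A.2, stab_one]⟩
  map_one' := Subtype.ext stab_one
  map_mul' A B := Subtype.ext (stab_mul h A.1 B.1)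

instance directedSystem :
    DirectedSystem (fun n : ℕ => Matrix.unitaryGroup (Fin n) ℂ) (incl · · ·) where
  map_self n A := Subtype.ext (stab_self A.1)
  map_map k j i hij hjk A := by
    refine Subtype.ext ?_
    ext a b
    exact pad_stab hij A.1 a b

end UnitaryLimit

/-- The infinite unitary group `U(∞)`: the direct limit of the groups `U(n)` along the inclusions
`A ↦ A ⊕ 1`. -/
def InfiniteUnitaryGroup : Type :=
  DirectLimit (fun n : ℕ => Matrix.unitaryGroup (Fin n) ℂ) UnitaryLimit.incl

namespace InfiniteUnitaryGroup

instance : Group InfiniteUnitaryGroup :=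
  inferInstanceAs (Group
    (DirectLimit (fun n : ℕ => Matrix.unitaryGroup (Fin n) ℂ) UnitaryLimit.incl))

/-- The inclusion `U(n) → U(∞)`. -/
def of (n : ℕ) (A : Matrix.unitaryGroup (Fin n) ℂ) : InfiniteUnitaryGroup :=
  Quotient.mk _ ⟨n, A⟩

/-- The inductive limit topology: the final topology with respect to all `U(n) → U(∞)`. -/
instance : TopologicalSpace InfiniteUnitaryGroup :=
  ⨆ n : ℕ, TopologicalSpace.coinduced (of n) inferInstance

end InfiniteUnitaryGroup

/-! ### Classifying spaces -/

/-- A space is weakly contractible if it is nonempty and all its homotopy groups, `π₀` included,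
are trivial for every base point. -/
def IsWeaklyContractible (E : Type*) [TopologicalSpace E] : Prop :=
  Nonempty E ∧ ∀ (n : ℕ) (x : E), Subsingleton (π_ n E x)

/-- `p : E → B` is a principal `G`-bundle: `G` acts continuously on `E` (on the left), preserving
the fibres of `p`, and `B` is covered by open sets `U` carrying a `G`-equivariant local
trivialization `p ⁻¹(U) ≃ₜ U × G`, with `G` acting on itself by multiplication. In particular the
action is free and its orbits are exactly the fibres of `p`, so `B` is the quotient `E / G`. -/
structure IsPrincipalBundle (G : Type*) {E B : Type*} [Group G] [TopologicalSpace G]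
    [TopologicalSpace E] [TopologicalSpace B] [MulAction G E] (p : E → B) : Prop where
  continuous_smul : Continuous fun q : G × E => q.1 • q.2
  proj_smul : ∀ (g : G) (x : E), p (g • x) = p x
  locally_trivial : ∀ b : B, ∃ e : Bundle.Trivialization G p, b ∈ e.baseSet ∧
    ∀ (g : G) (x : E), p x ∈ e.baseSet → e (g • x) = (p x, g * (e x).2)

/-- `B` is a classifying space of the topological group `G`: it is the base of a universal
principal `G`-bundle, i.e. of one whose total space is weakly contractible. -/
def IsClassifyingSpace.{t, v', w'} (G : Type t) [Group G] [TopologicalSpace G]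
    (B : Type v') [TopologicalSpace B] : Prop :=
  ∃ (E : Type w') (_ : TopologicalSpace E) (_ : MulAction G E) (p : E → B),
    IsPrincipalBundle G p ∧ IsWeaklyContractible E

/-! ### Weak homotopy equivalences -/

/-- The map `π_n(X, x) → π_n(Y, f x)` induced by a continuous map `f : X → Y`. -/
def homotopyGroupMap {X Y : Type*} [TopologicalSpace X] [TopologicalSpace Y] (f : C(X, Y))
    (n : ℕ) (x : X) : π_ n X x → π_ n Y (f x) :=
  Quotient.map
    (fun γ => (⟨f.comp γ.1, fun t ht => congrArg f (γ.2 t ht)⟩ : GenLoop (Fin n) Y (f x)))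
    (fun _ _ h => ContinuousMap.HomotopicRel.comp_continuousMap h f)

/-- A weak homotopy equivalence: a continuous map which induces bijections of all homotopy groups
(including the set `π₀`, whence the clause about the empty space) at all base points. -/
def IsWeakHomotopyEquiv {X Y : Type*} [TopologicalSpace X] [TopologicalSpace Y]
    (f : C(X, Y)) : Prop :=
  (Nonempty Y → Nonempty X) ∧
    ∀ (n : ℕ) (x : X), Function.Bijective (homotopyGroupMap f n x)

end

/-! Contractibility. All separable infinite-dimensional Hilbert spaces are isomorphic, so `H` may be
replaced by L² of a half line. There, left translation by s ≥ 0 followed by restriction is a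
coisometry V_s, strongly continuous in s, with V_0 = 1 and V_s → 0 strongly. Hence V_s* P V_s is
again a projection of the same trace as P, and it tends weakly to 0: in the weak topology the range
can escape to infinity. The bound ‖P‖ ≤ 1 gives joint continuity in (s, P), and reparametrizing [0,
∞] by [0, 1] contracts the space to the null projection (`contractibleSpace_weakGrassmannian`).

Classifying spaces. Only π₂(B) ≠ 0 is needed. The loop γ(t) = diag(exp(2πit), 1, 1, …) has
determinant of winding number one. Since π₁(E) = 0, the loop γ • x bounds a square in E, which
projects to a sphere in B. A null homotopy of this sphere would lift to E, and comparing the lift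
with the square would force the winding number of det ∘ γ to vanish
(`IsPrincipalBundle.not_nullhomotopic_of_winding`). A contractible space has trivial π₂ at every
base point, so π₂ excludes every equivalence, weak ones included. -/

noncomputable section

/-! ### Parseval's identity and Hilbert–Schmidt norms -/

namespace HilbertBasis

open scoped ENNReal

variable {𝕜 E F ι κ : Type*} [RCLike 𝕜] [NormedAddCommGroup E] [InnerProductSpace 𝕜 E]
  [NormedAddCommGroup F] [InnerProductSpace 𝕜 F]

/-- Parseval's identity. -/
theorem hasSum_norm_inner_sq (b : HilbertBasis ι 𝕜 E) (x : E) :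
    HasSum (fun i => ‖inner 𝕜 (b i) x‖ ^ 2) (‖x‖ ^ 2) := by
  have h := b.hasSum_inner_mul_inner x x
  have h2 := RCLike.hasSum_re 𝕜 h
  rw [inner_self_eq_norm_sq] at h2
  refine h2.congr_fun ?_
  intro i
  rw [← inner_conj_symm x (b i), RCLike.conj_mul]
  norm_cast

theorem tsum_enorm_inner_sq (b : HilbertBasis ι 𝕜 E) (x : E) :
    ∑' i, ‖inner 𝕜 (b i) x‖ₑ ^ 2 = ‖x‖ₑ ^ 2 := by
  have h := b.hasSum_norm_inner_sq x
  have h2 := ENNReal.ofReal_tsum_of_nonneg (fun i => sq_nonneg _) h.summable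
  rw [h.tsum_eq, ENNReal.ofReal_pow (norm_nonneg _), ofReal_norm] at h2
  rw [h2]
  congr 1 with i
  rw [ENNReal.ofReal_pow (norm_nonneg _), ofReal_norm]

/-- The Hilbert–Schmidt norms of an operator and of its adjoint agree. -/
theorem tsum_enorm_adjoint_sq [CompleteSpace E] [CompleteSpace F] (b : HilbertBasis ι 𝕜 E)
    (c : HilbertBasis κ 𝕜 F) (A : E →L[𝕜] F) :
    ∑' j, ‖ContinuousLinearMap.adjoint A (c j)‖ₑ ^ 2 = ∑' i, ‖A (b i)‖ₑ ^ 2 := by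
  simp_rw [← b.tsum_enorm_inner_sq (ContinuousLinearMap.adjoint A _),
    ← c.tsum_enorm_inner_sq (A _)]
  rw [ENNReal.tsum_comm]
  refine tsum_congr fun i => tsum_congr fun j => ?_
  rw [ContinuousLinearMap.adjoint_inner_right, ← inner_conj_symm, RCLike.enorm_conj]

end HilbertBasis

/-! ### Trace class projections and conjugation by coisometries -/

section TraceClass

variable {H K : Type*} [NormedAddCommGroup H] [InnerProductSpace ℂ H] [CompleteSpace H]
  [NormedAddCommGroup K] [InnerProductSpace ℂ K] [CompleteSpace K]

theorem IsStarProjection.re_inner_eq_norm_sq {P : H →L[ℂ] H} (hP : IsStarProjection P) (x : H) :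
    (inner ℂ x (P x)).re = ‖P x‖ ^ 2 := by
  have h1 : P (P x) = P x := congrArg (· x) hP.isIdempotentElem.eq
  have h2 : inner ℂ x (P x) = inner ℂ (P x) (P x) := by
    conv_lhs => rw [← h1]
    rw [← ContinuousLinearMap.adjoint_inner_left, ← ContinuousLinearMap.star_eq_adjoint,
      hP.isSelfAdjoint.star_eq]
  rw [h2]
  exact inner_self_eq_norm_sq (𝕜 := ℂ) _

theorem IsStarProjection.abs_eq {P : H →L[ℂ] H} (hP : IsStarProjection P) : CFC.abs P = P :=
  CFC.abs_of_nonneg P hP.nonneg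

theorem summable_norm_sq_iff_tsum_enorm_sq {E ι : Type*} [NormedAddCommGroup E] (f : ι → E) :
    (Summable fun i => ‖f i‖ ^ 2) ↔ ∑' i, ‖f i‖ₑ ^ 2 ≠ ⊤ := by
  have h : (fun i => ‖f i‖ ^ 2) = fun i => ((‖f i‖₊ ^ 2 : NNReal) : ℝ) := by ext; simp
  rw [h, NNReal.summable_coe, ← ENNReal.tsum_coe_ne_top_iff_summable]
  simp [enorm_eq_nnnorm]

/-- For a star projection, being trace class can be tested in any Hilbert basis. -/
theorem IsStarProjection.isTraceClass_iff {P : H →L[ℂ] H} (hP : IsStarProjection P) {ι : Type*}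
    (b : HilbertBasis ι ℂ H) : IsTraceClass P ↔ ∑' i, ‖P (b i)‖ₑ ^ 2 ≠ ⊤ := by
  -- Since ⟪x, P x⟫ = ‖P x‖², the trace of |P| = P is a squared Hilbert–Schmidt norm, and P = P*
  -- makes that norm independent of the basis.
  have key (κ : Type _) (c : HilbertBasis κ ℂ H) :
      ∑' j, ‖P (c j)‖ₑ ^ 2 = ∑' i, ‖P (b i)‖ₑ ^ 2 := by
    rw [← b.tsum_enorm_adjoint_sq c P, ← ContinuousLinearMap.star_eq_adjoint,
      hP.isSelfAdjoint.star_eq]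
  unfold IsTraceClass
  simp_rw [hP.abs_eq, hP.re_inner_eq_norm_sq, summable_norm_sq_iff_tsum_enorm_sq]
  refine ⟨fun ⟨s, c, h⟩ => key _ c ▸ h, fun h => ?_⟩
  obtain ⟨s, c, -⟩ := exists_hilbertBasis ℂ H
  exact ⟨s, c, (key _ c).symm ▸ h⟩

theorem zero_mem_traceClassProjections : (0 : H →L[ℂ] H) ∈ traceClassProjections H := by
  refine ⟨.zero _, ?_⟩
  obtain ⟨s, c, -⟩ := exists_hilbertBasis ℂ H
  simp [(IsStarProjection.zero (H →L[ℂ] H)).isTraceClass_iff c]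

/-- Conjugation by an isometry preserves the trace class projections. -/
theorem adjoint_comp_comp_mem_traceClassProjections {P : H →L[ℂ] H}
    (hP : P ∈ traceClassProjections H) {W : K →L[ℂ] H}
    (hW : W ∘L ContinuousLinearMap.adjoint W = 1) :
    ContinuousLinearMap.adjoint W ∘L P ∘L W ∈ traceClassProjections K := by
  have hW' (x : H) : W (ContinuousLinearMap.adjoint W x) = x := congrArg (· x) hW
  have hPP (x : H) : P (P x) = P x := congrArg (· x) hP.1.isIdempotentElem.eq
  have hPs : ContinuousLinearMap.adjoint P = P := hP.1.isSelfAdjoint.star_eq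
  have hproj : IsStarProjection (ContinuousLinearMap.adjoint W ∘L P ∘L W) := by
    refine ⟨?_, ?_⟩
    · ext x
      simp [hW', hPP]
    · rw [IsSelfAdjoint, ContinuousLinearMap.star_eq_adjoint]
      simp [ContinuousLinearMap.adjoint_comp, hPs, ContinuousLinearMap.comp_assoc]
  refine ⟨hproj, ?_⟩
  obtain ⟨s, b, -⟩ := exists_hilbertBasis ℂ H
  obtain ⟨t, c, -⟩ := exists_hilbertBasis ℂ K
  have hiso (x : H) : ‖ContinuousLinearMap.adjoint W x‖ₑ = ‖x‖ₑ := by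
    have h : ‖ContinuousLinearMap.adjoint W x‖ = ‖x‖ := by
      rw [← sq_eq_sq₀ (norm_nonneg _) (norm_nonneg _), ← inner_self_eq_norm_sq (𝕜 := ℂ),
        ContinuousLinearMap.adjoint_inner_left, hW', inner_self_eq_norm_sq]
    simp [enorm_eq_nnnorm, ← NNReal.coe_inj, h]
  rw [hproj.isTraceClass_iff c]
  simp only [ContinuousLinearMap.comp_apply, hiso]
  -- `W*` is isometric, so W*PW may be replaced by PW, whose adjoint W*P has the Hilbert–Schmidt
  -- norm of P.
  have h := b.tsum_enorm_adjoint_sq c (ContinuousLinearMap.adjoint W ∘L P)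
  simp only [ContinuousLinearMap.adjoint_comp, ContinuousLinearMap.adjoint_adjoint, hPs,
    ContinuousLinearMap.comp_apply, hiso] at h
  rw [h, ← hP.1.isTraceClass_iff b]
  exact hP.2

/-- A strongly continuous path of coisometries from the identity to zero contracts the
space of trace class projections in the weak operator topology. -/
theorem contractibleSpace_weakGrassmannian_of_coisometries (W : I → H →L[ℂ] H)
    (hW : ∀ x, Continuous fun t => W t x) (hW0 : W 0 = 1) (hW1 : W 1 = 0)
    (hco : ∀ t ≠ 1, W t ∘L ContinuousLinearMap.adjoint (W t) = 1) :
    ContractibleSpace (WeakGrassmannian H) := by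
  have hmem (t : I) (P : WeakGrassmannian H) :
      ContinuousLinearMap.adjoint (W t) ∘L P.1.toCLM ∘L W t ∈ traceClassProjections H := by
    by_cases ht : t = 1
    · subst ht
      simpa [hW1] using zero_mem_traceClassProjections
    · exact adjoint_comp_comp_mem_traceClassProjections P.2 (hco t ht)
  rw [contractible_iff_id_nullhomotopic]
  refine ⟨⟨.ofCLM 0, zero_mem_traceClassProjections⟩, ⟨⟨⟨fun q =>
    ⟨.ofCLM (ContinuousLinearMap.adjoint (W q.1) ∘L q.2.1.toCLM ∘L W q.1), hmem q.1 q.2⟩, ?_⟩,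
    fun P => ?_, fun P => ?_⟩⟩⟩
  · refine Continuous.subtype_mk ?_ _
    rw [ContinuousLinearMapWOT.continuous_iff]
    intro x y
    simp only [ContinuousLinearMapWOT.ofCLM_apply, ContinuousLinearMap.comp_apply,
      ContinuousLinearMap.adjoint_inner_right]
    rw [continuous_iff_continuousAt]
    rintro ⟨t₀, P₀⟩
    have hnorm (P : WeakGrassmannian H) (z : H) : ‖P.1.toCLM z‖ ≤ ‖z‖ := by
      refine (P.1.toCLM.le_opNorm z).trans ?_
      exact mul_le_of_le_one_left (norm_nonneg _) P.2.1.norm_le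
    have h1 : Filter.Tendsto (fun q : I × WeakGrassmannian H =>
        inner ℂ (W t₀ y) (q.2.1.toCLM (W t₀ x))) (𝓝 (t₀, P₀))
        (𝓝 (inner ℂ (W t₀ y) (P₀.1.toCLM (W t₀ x)))) := by
      have := (ContinuousLinearMapWOT.continuous_iff.1
        (continuous_subtype_val (p := fun P : H →WOT[ℂ] H => P.toCLM ∈ traceClassProjections H)))
        (W t₀ x) (W t₀ y)
      exact (this.comp continuous_snd).tendsto (t₀, P₀)
    -- Weak continuity in P applies only to the frozen vectors `W t₀ x` and `W t₀ y`; the error from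
    -- moving them is small uniformly in P because ‖P‖ ≤ 1.
    refine h1.congr_dist ?_
    have hx : Filter.Tendsto (fun q : I × WeakGrassmannian H => W q.1 x) (𝓝 (t₀, P₀))
      (𝓝 (W t₀ x)) := ((hW x).comp continuous_fst).tendsto (t₀, P₀)
    have hy : Filter.Tendsto (fun q : I × WeakGrassmannian H => W q.1 y) (𝓝 (t₀, P₀))
      (𝓝 (W t₀ y)) := ((hW y).comp continuous_fst).tendsto (t₀, P₀)
    have hb : Filter.Tendsto (fun q : I × WeakGrassmannian H =>
        ‖W t₀ y - W q.1 y‖ * ‖W t₀ x‖ + ‖W q.1 y‖ * ‖W t₀ x - W q.1 x‖) (𝓝 (t₀, P₀)) (𝓝 0) := by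
      have := (((tendsto_const_nhds (x := W t₀ y)).sub hy).norm.mul
        (tendsto_const_nhds (x := ‖W t₀ x‖))).add
        (hy.norm.mul ((tendsto_const_nhds (x := W t₀ x)).sub hx).norm)
      simpa using this
    refine squeeze_zero (fun _ => dist_nonneg) (fun q => ?_) hb
    rw [dist_eq_norm]
    have : inner ℂ (W t₀ y) (q.2.1.toCLM (W t₀ x)) - inner ℂ (W q.1 y) (q.2.1.toCLM (W q.1 x)) =
        inner ℂ (W t₀ y - W q.1 y) (q.2.1.toCLM (W t₀ x)) +
        inner ℂ (W q.1 y) (q.2.1.toCLM (W t₀ x - W q.1 x)) := by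
      simp
    rw [this]
    refine (norm_add_le _ _).trans (add_le_add ?_ ?_) <;>
    exact (norm_inner_le_norm _ _).trans (mul_le_mul_of_nonneg_left (hnorm _ _) (norm_nonneg _))
  · refine Subtype.ext ?_
    simp [hW0, ContinuousLinearMapWOT.ext_iff, ← ContinuousLinearMap.star_eq_adjoint]
  · refine Subtype.ext ?_
    simp [hW1]

end TraceClass

/-! ### Uniqueness of the separable infinite-dimensional Hilbert space -/

section HilbertBasisCountable

variable {H : Type*} [NormedAddCommGroup H] [InnerProductSpace ℂ H]

/-- Distinct members are √2 apart, so balls of radius 1/2 around them are disjoint open sets, and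
separability allows only countably many. -/
theorem Orthonormal.countable_of_separableSpace [TopologicalSpace.SeparableSpace H] {ι : Type*}
    {v : ι → H} (hv : Orthonormal ℂ v) : Countable ι := by
  have hdist (i j : ι) (hij : i ≠ j) : 1 ≤ dist (v i) (v j) := by
    have h1 : ‖v i - v j‖ ^ 2 = 2 := by
      rw [@norm_sub_sq ℂ, hv.1, hv.1, hv.2 hij]
      norm_num
    rw [dist_eq_norm]
    nlinarith [norm_nonneg (v i - v j)]
  have hd : Pairwise (Function.onFun Disjoint fun i => Metric.ball (v i) (1 / 2)) := by
    intro i j hij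
    refine Metric.ball_disjoint_ball ?_
    linarith [hdist i j hij]
  rw [← Set.countable_univ_iff]
  exact Set.PairwiseDisjoint.countable_of_isOpen (hd.set_pairwise _)
    (fun i _ => Metric.isOpen_ball) (fun i _ => ⟨v i, Metric.mem_ball_self (by norm_num)⟩)

theorem HilbertBasis.infinite_index {ι : Type*} (b : HilbertBasis ι ℂ H)
    (hH : ¬ FiniteDimensional ℂ H) : Infinite ι := by
  by_contra hι
  rw [not_infinite_iff_finite] at hι
  have := Fintype.ofFinite ι
  exact hH b.toOrthonormalBasis.toBasis.finiteDimensional_of_finite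

/-- All separable infinite-dimensional Hilbert spaces are isomorphic. -/
theorem nonempty_linearIsometryEquiv_of_separableSpace (H K : Type*)
    [NormedAddCommGroup H] [InnerProductSpace ℂ H] [CompleteSpace H]
    [NormedAddCommGroup K] [InnerProductSpace ℂ K] [CompleteSpace K]
    [TopologicalSpace.SeparableSpace H] [TopologicalSpace.SeparableSpace K]
    (hH : ¬ FiniteDimensional ℂ H) (hK : ¬ FiniteDimensional ℂ K) : Nonempty (H ≃ₗᵢ[ℂ] K) := by
  obtain ⟨s, b, -⟩ := exists_hilbertBasis ℂ H
  obtain ⟨t, c, -⟩ := exists_hilbertBasis ℂ K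
  have := b.orthonormal.countable_of_separableSpace
  have := c.orthonormal.countable_of_separableSpace
  have := b.infinite_index hH
  have := c.infinite_index hK
  obtain ⟨e⟩ : Nonempty (s ≃ t) := nonempty_equiv_of_countable
  let c' : HilbertBasis s ℂ K := HilbertBasis.mk (v := c ∘ e)
    (c.orthonormal.comp _ e.injective) (by
      rw [Set.range_comp, e.range_eq_univ, Set.image_univ, c.dense_span])
  exact ⟨b.repr.trans c'.repr.symm⟩

end HilbertBasisCountable

/-! ### The translation semigroup on the half line -/

section HalfLine

open MeasureTheory Filter ContinuousLinearMap

/-- Translation by `s` on `L²(ℝ)`. -/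
def translateL2 (s : ℝ) : Lp ℂ 2 (volume : Measure ℝ) →ₗᵢ[ℂ] Lp ℂ 2 (volume : Measure ℝ) :=
  Lp.compMeasurePreservingₗᵢ ℂ (fun x => x - s) (measurePreserving_sub_right volume s)

theorem coeFn_translateL2 (s : ℝ) (f : Lp ℂ 2 (volume : Measure ℝ)) :
    translateL2 s f =ᵐ[volume] fun x => f (x - s) :=
  Lp.coeFn_compMeasurePreserving f (measurePreserving_sub_right volume s)

theorem translateL2_neg_translateL2 (s : ℝ) (f : Lp ℂ 2 (volume : Measure ℝ)) :
    translateL2 (-s) (translateL2 s f) = f := by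
  refine Lp.ext ?_
  have h := (measurePreserving_sub_right volume (-s)).quasiMeasurePreserving.ae_eq_comp
    (coeFn_translateL2 s f)
  filter_upwards [coeFn_translateL2 (-s) (translateL2 s f), h] with x h1 h2
  rw [h1]
  simpa using h2

theorem translateL2_zero (f : Lp ℂ 2 (volume : Measure ℝ)) : translateL2 0 f = f := by
  refine Lp.ext ?_
  filter_upwards [coeFn_translateL2 0 f] with x h1
  simpa using h1

theorem adjoint_translateL2 (s : ℝ) :
    adjoint (translateL2 s).toContinuousLinearMap = (translateL2 (-s)).toContinuousLinearMap := by
  refine ((eq_adjoint_iff _ _).2 fun f g => ?_).symm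
  have h := (translateL2 (-s)).inner_map_map f (translateL2 s g)
  rw [translateL2_neg_translateL2] at h
  exact h

theorem continuous_translateL2 (f : Lp ℂ 2 (volume : Measure ℝ)) :
    Continuous fun s => translateL2 s f := by
  let g : C(ℝ × ℝ, ℝ) := ⟨fun q => q.2 - q.1, by fun_prop⟩
  exact Continuous.compMeasurePreservingLp (f := fun _ : ℝ => f) (g := g.curry) continuous_const
    g.curry.continuous (measurePreserving_sub_right volume) ENNReal.ofNat_ne_top

/-- The square integrable functions on the line which vanish on the negative half line. -/
def halfLineL2 : Submodule ℂ (Lp ℂ 2 (volume : Measure ℝ)) :=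
  LinearMap.ker (LpToLpRestrictCLM ℝ ℂ ℂ volume 2 (Set.Iio 0)).toLinearMap

instance : TopologicalSpace.SeparableSpace halfLineL2 :=
  have : Fact ((2 : ENNReal) ≠ ⊤) := ⟨ENNReal.ofNat_ne_top⟩
  inferInstanceAs (TopologicalSpace.SeparableSpace (halfLineL2 : Set (Lp ℂ 2 (volume : Measure ℝ))))

instance : CompleteSpace halfLineL2 :=
  (LpToLpRestrictCLM ℝ ℂ ℂ volume 2 (Set.Iio 0)).isClosed_ker.completeSpace_coe

theorem mem_halfLineL2_iff {f : Lp ℂ 2 (volume : Measure ℝ)} :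
    f ∈ halfLineL2 ↔ ∀ᵐ x, x < 0 → f x = 0 := by
  have h := LpToLpRestrictCLM_coeFn ℂ (μ := volume) (Set.Iio (0 : ℝ)) f
  rw [halfLineL2, LinearMap.mem_ker]
  change LpToLpRestrictCLM ℝ ℂ ℂ volume 2 (Set.Iio 0) f = 0 ↔ _
  rw [Lp.ext_iff, h.congr_left.trans (Lp.coeFn_zero ℂ 2 _).congr_right,
    EventuallyEq, ae_restrict_iff' measurableSet_Iio]
  rfl

theorem translateL2_eq_zero {f : Lp ℂ 2 (volume : Measure ℝ)} (hf : f ∈ halfLineL2) (s : ℝ) :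
    ∀ᵐ x, x < s → translateL2 s f x = 0 := by
  have h := (measurePreserving_sub_right volume s).quasiMeasurePreserving.ae
    (mem_halfLineL2_iff.1 hf)
  filter_upwards [h, coeFn_translateL2 s f] with x h1 h2 hx
  rw [h2, h1 (by linarith)]

theorem translateL2_mem_halfLineL2 {f : Lp ℂ 2 (volume : Measure ℝ)} (hf : f ∈ halfLineL2)
    {s : ℝ} (hs : 0 ≤ s) : translateL2 s f ∈ halfLineL2 := by
  rw [mem_halfLineL2_iff]
  filter_upwards [translateL2_eq_zero hf s] with x hx h0
  exact hx (by linarith)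

/-- Left translation by `s` on the half line, followed by restriction to the half line. -/
def truncatedTranslate (s : ℝ) : halfLineL2 →L[ℂ] halfLineL2 :=
  adjoint halfLineL2.subtypeL ∘L (translateL2 (-s)).toContinuousLinearMap ∘L halfLineL2.subtypeL

theorem adjoint_subtypeL_halfLineL2 (f : halfLineL2) : adjoint halfLineL2.subtypeL f = f := by
  refine ext_inner_right ℂ fun g => ?_
  rw [adjoint_inner_left]
  rfl

theorem adjoint_truncatedTranslate (s : ℝ) : adjoint (truncatedTranslate s) =
    adjoint halfLineL2.subtypeL ∘L (translateL2 s).toContinuousLinearMap ∘L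
      halfLineL2.subtypeL := by
  simp [truncatedTranslate, adjoint_comp, adjoint_translateL2, comp_assoc]

theorem coe_adjoint_truncatedTranslate {s : ℝ} (hs : 0 ≤ s) (f : halfLineL2) :
    (adjoint (truncatedTranslate s) f : Lp ℂ 2 (volume : Measure ℝ)) = translateL2 s f := by
  rw [adjoint_truncatedTranslate]
  exact congrArg Subtype.val
    (adjoint_subtypeL_halfLineL2 ⟨translateL2 s f, translateL2_mem_halfLineL2 f.2 hs⟩)

theorem truncatedTranslate_comp_adjoint {s : ℝ} (hs : 0 ≤ s) :
    truncatedTranslate s ∘L adjoint (truncatedTranslate s) = 1 := by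
  ext1 f
  simp only [comp_apply, truncatedTranslate, Submodule.subtypeL_apply]
  rw [← truncatedTranslate, coe_adjoint_truncatedTranslate hs]
  change adjoint halfLineL2.subtypeL (translateL2 (-s) (translateL2 s f)) = f
  rw [translateL2_neg_translateL2, adjoint_subtypeL_halfLineL2]

theorem truncatedTranslate_zero : truncatedTranslate 0 = 1 := by
  ext1 f
  change adjoint halfLineL2.subtypeL (translateL2 (-0) f) = f
  rw [neg_zero, translateL2_zero, adjoint_subtypeL_halfLineL2]

theorem continuous_truncatedTranslate (f : halfLineL2) :
    Continuous fun s => truncatedTranslate s f :=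
  (adjoint halfLineL2.subtypeL).continuous.comp
    ((continuous_translateL2 f).comp continuous_neg)

/-- With k the translate of f, ‖k‖² is the inner product of f with the right translate of k. The
latter lives on [s, ∞), so only the tail of f contributes, and Cauchy–Schwarz concludes. -/
theorem norm_truncatedTranslate_le {s : ℝ} (hs : 0 ≤ s) (f : halfLineL2) :
    ‖truncatedTranslate s f‖ ≤
      ‖LpToLpRestrictCLM ℝ ℂ ℂ volume 2 (Set.Ici s) (f : Lp ℂ 2 (volume : Measure ℝ))‖ := by
  set R := LpToLpRestrictCLM ℝ ℂ ℂ (volume : Measure ℝ) 2 (Set.Ici s)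
  set k := truncatedTranslate s f
  have hR (g : Lp ℂ 2 (volume : Measure ℝ)) : ‖R g‖ ≤ ‖g‖ := norm_Lp_toLp_restrict_le _ g
  have h1 : inner ℂ k k = inner ℂ (f : Lp ℂ 2 (volume : Measure ℝ)) (translateL2 s k) := by
    rw [← coe_adjoint_truncatedTranslate hs k]
    exact (adjoint_inner_right (truncatedTranslate s) f k).symm
  have h2 : inner ℂ (f : Lp ℂ 2 (volume : Measure ℝ)) (translateL2 s k) =
      inner ℂ (R f) (R (translateL2 s k)) := by
    rw [L2.inner_def, L2.inner_def]
    have e1 := LpToLpRestrictCLM_coeFn ℂ (μ := volume) (Set.Ici s)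
      (f : Lp ℂ 2 (volume : Measure ℝ))
    have e2 := LpToLpRestrictCLM_coeFn ℂ (μ := volume) (Set.Ici s) (translateL2 s k)
    rw [← setIntegral_eq_integral_of_ae_compl_eq_zero (s := Set.Ici s)]
    · refine integral_congr_ae ?_
      filter_upwards [e1, e2] with x hx1 hx2
      rw [hx1, hx2]
    · filter_upwards [translateL2_eq_zero k.2 s] with x hx hxs
      rw [hx (not_le.1 hxs), inner_zero_right]
  have h0 : ‖k‖ ^ 2 = ‖inner ℂ k k‖ := by
    simp
  have h3 : ‖k‖ ^ 2 ≤ ‖R f‖ * ‖k‖ := by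
    calc ‖k‖ ^ 2 = ‖inner ℂ k k‖ := h0
      _ ≤ ‖R f‖ * ‖R (translateL2 s k)‖ := by rw [h1, h2]; exact norm_inner_le_norm _ _
      _ ≤ ‖R f‖ * ‖k‖ := by
        gcongr
        exact (hR _).trans ((translateL2 s).norm_map _).le
  rcases (norm_nonneg k).eq_or_lt with h | h
  · rw [← h]; exact norm_nonneg _
  · rw [sq] at h3
    exact le_of_mul_le_mul_right h3 h

theorem tendsto_norm_restrict_Ici (f : Lp ℂ 2 (volume : Measure ℝ)) :
    Tendsto (fun s : ℝ => ‖LpToLpRestrictCLM ℝ ℂ ℂ volume 2 (Set.Ici s) f‖) atTop (𝓝 0) := by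
  have hint : Integrable (fun x => ‖f x‖ ^ 2) := (memLp_two_iff_integrable_sq_norm
    (Lp.aestronglyMeasurable f)).1 (Lp.memLp f)
  have h1 (s : ℝ) : ‖LpToLpRestrictCLM ℝ ℂ ℂ volume 2 (Set.Ici s) f‖ ^ 2 =
      ∫ x in Set.Ici s, ‖f x‖ ^ 2 := by
    have e1 := LpToLpRestrictCLM_coeFn ℂ (μ := volume) (Set.Ici s) f
    rw [← inner_self_eq_norm_sq (𝕜 := ℂ), L2.inner_def, ← integral_re]
    · refine integral_congr_ae ?_
      filter_upwards [e1] with x hx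
      rw [hx, inner_self_eq_norm_sq]
    · exact L2.integrable_inner _ _
  have h2 : Tendsto (fun s : ℝ => ∫ x in Set.Ici s, ‖f x‖ ^ 2) atTop (𝓝 0) := by
    have := tendsto_setIntegral_of_antitone (μ := volume) (f := fun x => ‖f x‖ ^ 2)
      (s := fun s : ℝ => Set.Ici s) (fun _ => measurableSet_Ici)
      (fun a b h => Set.Ici_subset_Ici.2 h) ⟨0, hint.integrableOn⟩
    have he : ⋂ s : ℝ, Set.Ici s = ∅ := by
      ext x
      simpa using ⟨x + 1, by linarith⟩
    simpa [he] using this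
  have h3 := h2.sqrt
  simp_rw [← h1, Real.sqrt_sq (norm_nonneg _), Real.sqrt_zero] at h3
  exact h3

theorem tendsto_truncatedTranslate (f : halfLineL2) :
    Tendsto (fun s => truncatedTranslate s f) atTop (𝓝 0) := by
  rw [tendsto_zero_iff_norm_tendsto_zero]
  refine squeeze_zero' (.of_forall fun _ => norm_nonneg _) ?_
    (tendsto_norm_restrict_Ici (f : Lp ℂ 2 (volume : Measure ℝ)))
  filter_upwards [eventually_ge_atTop 0] with s hs using norm_truncatedTranslate_le hs f

/-- In finite dimension a one-sided inverse is two-sided, so the truncated translations would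
preserve norms, although they tend strongly to zero. -/
theorem not_finiteDimensional_halfLineL2 : ¬ FiniteDimensional ℂ halfLineL2 := by
  intro hfin
  obtain ⟨f, hf⟩ : ∃ f : halfLineL2, f ≠ 0 := by
    refine ⟨⟨indicatorConstLp 2 (measurableSet_Icc (a := (0 : ℝ)) (b := 1)) (by simp) (1 : ℂ),
      ?_⟩, ?_⟩
    · rw [mem_halfLineL2_iff]
      filter_upwards [indicatorConstLp_coeFn (p := 2) (hs := measurableSet_Icc (a := (0 : ℝ))
        (b := 1)) (hμs := by simp) (c := (1 : ℂ))] with x hx h0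
      rw [hx, Set.indicator_of_notMem]
      simp [h0]
    · intro h
      have := congrArg (fun g : halfLineL2 => ‖(g : Lp ℂ 2 (volume : Measure ℝ))‖) h
      simp [norm_indicatorConstLp] at this
  have hnorm (s : ℝ) (hs : 0 ≤ s) : ‖truncatedTranslate s f‖ = ‖f‖ := by
    have h1 : adjoint (truncatedTranslate s) ∘L truncatedTranslate s = 1 := by
      have := mul_eq_one_comm.1
        (congrArg ContinuousLinearMap.toLinearMap (truncatedTranslate_comp_adjoint hs))
      ext1 g
      exact congrArg (· g) this
    have h2 : adjoint (truncatedTranslate s) (truncatedTranslate s f) = f := congrArg (· f) h1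
    have h3 := coe_adjoint_truncatedTranslate hs (truncatedTranslate s f)
    rw [h2] at h3
    have h4 := congrArg norm h3
    rw [(translateL2 s).norm_map] at h4
    exact h4.symm
  have h := (tendsto_truncatedTranslate f).norm
  rw [norm_zero] at h
  have h' : Tendsto (fun s => ‖truncatedTranslate s f‖) atTop (𝓝 ‖f‖) :=
    tendsto_const_nhds.congr' (by
      filter_upwards [eventually_ge_atTop 0] with s hs using (hnorm s hs).symm)
  exact hf (norm_eq_zero.1 (tendsto_nhds_unique h' h))

end HalfLine

/-- The space of trace class projections of a separable infinite-dimensional Hilbert space is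
contractible in the weak operator topology. -/
theorem contractibleSpace_weakGrassmannian (H : Type*) [NormedAddCommGroup H]
    [InnerProductSpace ℂ H] [CompleteSpace H] [TopologicalSpace.SeparableSpace H]
    (hH : ¬ FiniteDimensional ℂ H) : ContractibleSpace (WeakGrassmannian H) := by
  obtain ⟨e⟩ := nonempty_linearIsometryEquiv_of_separableSpace H halfLineL2 hH
    not_finiteDimensional_halfLineL2
  let V (s : ℝ) : H →L[ℂ] H := (e.symm : halfLineL2 →L[ℂ] H) ∘L truncatedTranslate s ∘L
    (e : H →L[ℂ] halfLineL2)
  have hV (s : ℝ) (hs : 0 ≤ s) : V s ∘L ContinuousLinearMap.adjoint (V s) = 1 := by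
    have h (f : halfLineL2) : truncatedTranslate s
        (ContinuousLinearMap.adjoint (truncatedTranslate s) f) = f :=
      congrArg (· f) (truncatedTranslate_comp_adjoint hs)
    have h1 : ContinuousLinearMap.adjoint (e : H →L[ℂ] halfLineL2) = e.symm := e.adjoint_eq_symm
    have h2 : ContinuousLinearMap.adjoint (e.symm : halfLineL2 →L[ℂ] H) = e :=
      e.symm.adjoint_eq_symm
    ext x
    simp only [V, ContinuousLinearMap.adjoint_comp, h1, h2]
    change e.symm (truncatedTranslate s (e (e.symm
      (ContinuousLinearMap.adjoint (truncatedTranslate s) (e x))))) = x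
    rw [e.apply_symm_apply, h, e.symm_apply_apply]
  let ρ (t : I) : ℝ := (t : ℝ) / (1 - t)
  have hρ (t : I) : 0 ≤ ρ t := div_nonneg t.2.1 (sub_nonneg.2 t.2.2)
  classical
  -- The value at `t = 1` must be imposed: division by zero makes `ρ 1 = 0`, which would give `V 0 =
  -- 1`.
  refine contractibleSpace_weakGrassmannian_of_coisometries
    (fun t => if t = 1 then 0 else V (ρ t)) (fun x => ?_) ?_ (by simp) ?_
  · rw [continuous_iff_continuousAt]
    intro t
    by_cases ht : t = 1
    · subst ht
      have h1 : Filter.Tendsto (fun s => V s x) Filter.atTop (𝓝 0) := by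
        have := e.symm.continuous.tendsto 0 |>.comp (tendsto_truncatedTranslate (e x))
        rw [map_zero] at this
        exact this
      have h2 : Filter.Tendsto ρ (𝓝[≠] 1) Filter.atTop := by
        have h3 : Filter.Tendsto (fun t : I => 1 - (t : ℝ)) (𝓝[≠] 1) (𝓝[>] 0) := by
          refine tendsto_nhdsWithin_iff.2 ⟨?_, ?_⟩
          · have : Continuous fun t : I => 1 - (t : ℝ) := by fun_prop
            simpa using (this.tendsto 1).mono_left nhdsWithin_le_nhds
          · filter_upwards [self_mem_nhdsWithin] with t ht
            exact sub_pos.2 (lt_of_le_of_ne t.2.2 fun h => ht (Subtype.ext h))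
        have h4 : Filter.Tendsto (fun t : I => (t : ℝ)) (𝓝[≠] 1) (𝓝 1) :=
          (continuous_subtype_val.tendsto (1 : I)).mono_left nhdsWithin_le_nhds
        exact h4.pos_mul_atTop one_pos (tendsto_inv_nhdsGT_zero.comp h3)
      rw [continuousAt_iff_punctured_nhds]
      simp only [if_true, zero_apply]
      refine (h1.comp h2).congr' ?_
      filter_upwards [self_mem_nhdsWithin] with t ht
      simp [show t ≠ 1 from ht]
    · have h1 : ContinuousAt (fun t => V (ρ t) x) t := by
        have h2 : ContinuousAt ρ t := by
          refine ContinuousAt.div (by fun_prop) (by fun_prop) ?_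
          exact sub_ne_zero.2 fun h => ht (Subtype.ext h.symm)
        have h3 : Continuous fun s => V s x :=
          e.symm.continuous.comp (continuous_truncatedTranslate (e x))
        exact h3.continuousAt.comp h2
      refine h1.congr ?_
      filter_upwards [isOpen_ne.mem_nhds ht] with t ht
      simp [show t ≠ 1 from ht]
  · have : V 0 = 1 := by
      ext x
      simp [V, truncatedTranslate_zero]
    simpa [ρ] using this
  · intro t ht
    simpa [ht] using hV (ρ t) (hρ t)

/-! ### Vanishing of π₂ for contractible spaces -/

section Contractible

/-- The distance of a point of the square to the boundary of the square. -/
def squareDepth (y : Fin 2 → I) : ℝ :=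
  min (min (y 0 : ℝ) (1 - y 0)) (min (y 1 : ℝ) (1 - y 1))

/-- The dilation of the square by the factor `1 + 2 s` about its centre, followed by the
retraction to the square. -/
def squareDilate (s : I) (y : Fin 2 → I) : Fin 2 → I :=
  fun i => Set.projIcc 0 1 zero_le_one (((y i : ℝ) - 1 / 2) * (1 + 2 * s) + 1 / 2)

theorem squareDilate_zero (y : Fin 2 → I) : squareDilate 0 y = y := by
  funext i
  simp [squareDilate]

/-- A coordinate y < s/4 goes to y(1 + 2s) - s, which is negative or zero because s ≤ 1; coordinates
near 1 are symmetric. -/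
theorem squareDilate_mem_boundary {s : I} {y : Fin 2 → I} (h : 4 * squareDepth y < s) :
    squareDilate s y ∈ Cube.boundary (Fin 2) := by
  have hs0 := s.2.1
  have hs1 := s.2.2
  have low (i : Fin 2) (hi : 4 * (y i : ℝ) < s) : squareDilate s y ∈ Cube.boundary (Fin 2) := by
    refine ⟨i, Or.inl (Set.projIcc_of_le_left _ ?_)⟩
    have := (y i).2.1
    nlinarith
  have high (i : Fin 2) (hi : 4 * (1 - (y i : ℝ)) < s) :
      squareDilate s y ∈ Cube.boundary (Fin 2) := by
    refine ⟨i, Or.inr (Set.projIcc_of_right_le _ ?_)⟩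
    have := (y i).2.2
    nlinarith
  rw [← lt_div_iff₀' (by norm_num), squareDepth] at h
  simp only [min_lt_iff] at h
  simp only [lt_div_iff₀' (show (0 : ℝ) < 4 by norm_num)] at h
  rcases h with (h | h) | (h | h)
  exacts [low 0 h, high 0 h, low 1 h, high 1 h]

theorem squareDepth_nonneg (y : Fin 2 → I) : 0 ≤ squareDepth y := by
  have := fun i => (y i).2.1
  have := fun i => (y i).2.2
  simp [squareDepth, *]

theorem squareDepth_of_mem_boundary {y : Fin 2 → I} (hy : y ∈ Cube.boundary (Fin 2)) :
    squareDepth y = 0 := by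
  refine le_antisymm ?_ (squareDepth_nonneg y)
  obtain ⟨i, hi⟩ := hy
  fin_cases i <;> rcases hi with hi | hi <;> simp at hi <;> simp [squareDepth, hi]

theorem continuous_squareDepth : Continuous squareDepth := by
  unfold squareDepth
  fun_prop

theorem continuous_squareDilate : Continuous fun q : I × (Fin 2 → I) => squareDilate q.1 q.2 := by
  unfold squareDilate
  refine continuous_pi fun i => continuous_projIcc.comp ?_
  fun_prop

/-- The second homotopy group of a contractible space vanishes at every base point. -/
theorem subsingleton_pi_two_of_contractibleSpace (X : Type*) [TopologicalSpace X]
    [ContractibleSpace X] (x : X) : Subsingleton (π_ 2 X x) := by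
  obtain ⟨x₀, ⟨h⟩⟩ := id_nullhomotopic X
  let clamp : ℝ → I := Set.projIcc 0 1 zero_le_one
  have clamp0 : clamp 0 = 0 := Set.projIcc_left _
  have hclamp : Continuous clamp := continuous_projIcc
  suffices key : ∀ f : GenLoop (Fin 2) X x, GenLoop.Homotopic f GenLoop.const by
    refine ⟨fun a b => ?_⟩
    induction a using Quotient.inductionOn
    induction b using Quotient.inductionOn
    exact Quotient.sound ((key _).trans (key _).symm)
  intro f
  -- The contraction need not fix `x`. The intermediate square is the constant `x₀` at depth at
  -- least 1/4, joined to the boundary by a collar following the track of `x`.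
  let m : C(Fin 2 → I, X) := ⟨fun y => h (clamp (4 * squareDepth y), x), by
    have := continuous_squareDepth
    fun_prop⟩
  have hm : ∀ y ∈ Cube.boundary (Fin 2), m y = x := fun y hy => by
    simp [m, squareDepth_of_mem_boundary hy, clamp0]
  let g : GenLoop (Fin 2) X x := ⟨m, hm⟩
  -- At time s the square f, shrunk towards the centre, is pushed along `h` for time s; in the
  -- collar `4 * squareDepth < s` the dilated point is already on the boundary, so the collar runs
  -- along the track of `x`.
  have hF : Continuous fun q : I × (Fin 2 → I) =>
      h (clamp (min (q.1 : ℝ) (4 * squareDepth q.2)), f.1 (squareDilate q.1 q.2)) := by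
    have h1 := continuous_squareDepth
    have h2 := continuous_squareDilate
    have h3 := f.1.continuous
    refine h.continuous.comp (Continuous.prodMk ?_ ?_)
    · fun_prop
    · exact h3.comp h2
  have hfg : GenLoop.Homotopic f g := by
    refine ⟨⟨⟨⟨_, hF⟩, fun y => ?_, fun y => ?_⟩, fun s y hy => ?_⟩⟩
    · have : min (0 : ℝ) (4 * squareDepth y) = 0 :=
        min_eq_left (by linarith [squareDepth_nonneg y])
      simp [this, clamp0, squareDilate_zero]
    · by_cases hy : 4 * squareDepth y < 1
      · have hb := squareDilate_mem_boundary (s := 1) (by simpa using hy)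
        simp [GenLoop.boundary f _ hb, hy.le, g, m]
      · push Not at hy
        have h1 : clamp (4 * squareDepth y) = 1 := Set.projIcc_of_right_le _ hy
        have h2 : clamp 1 = 1 := Set.projIcc_right _
        simp [min_eq_left hy, h2, g, m, h1]
    · have hd : squareDilate s y ∈ Cube.boundary (Fin 2) := by
        by_cases hs : (0 : ℝ) < s
        · exact squareDilate_mem_boundary (by simpa [squareDepth_of_mem_boundary hy] using hs)
        · have : s = 0 := le_antisymm (not_lt.1 hs) s.2.1
          simpa [this, squareDilate_zero] using hy
      have hs := s.2.1
      simp [squareDepth_of_mem_boundary hy, GenLoop.boundary f _ hd, GenLoop.boundary f _ hy,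
        min_eq_right hs, clamp0]
  have hgc : GenLoop.Homotopic g GenLoop.const := by
    -- Since `g` depends only on a position on the track of `x`, shortening that track to its start
    -- contracts it.
    have hG : Continuous fun q : I × (Fin 2 → I) =>
        h (clamp ((1 - (q.1 : ℝ)) * (4 * squareDepth q.2)), x) := by
      have h1 := continuous_squareDepth
      fun_prop
    refine ⟨⟨⟨⟨_, hG⟩, fun y => ?_, fun y => ?_⟩, fun s y hy => ?_⟩⟩
    · simp [g, m]
    · simp [clamp0]
    · simp [squareDepth_of_mem_boundary hy, clamp0, hm y hy, g]
  exact hfg.trans hgc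

end Contractible

/-! ### Principal bundles: comparison of lifts and lifting of cubes -/

namespace IsPrincipalBundle

variable {G E B : Type*} [Group G] [TopologicalSpace G] [TopologicalSpace E]
  [TopologicalSpace B] [MulAction G E] {p : E → B}

theorem continuous_proj (hp : IsPrincipalBundle G p) : Continuous p := by
  rw [continuous_iff_continuousAt]
  intro x
  obtain ⟨e, he, -⟩ := hp.locally_trivial (p x)
  exact e.continuousAt_proj (e.mem_source.2 he)

theorem eq_of_smul_eq (hp : IsPrincipalBundle G p) {g g' : G} {x : E} (h : g • x = g' • x) :
    g = g' := by
  obtain ⟨e, he, hsmul⟩ := hp.locally_trivial (p x)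
  have h2 := congrArg e h
  rw [hsmul g x he, hsmul g' x he] at h2
  exact mul_right_cancel (congrArg Prod.snd h2)

theorem exists_smul_eq (hp : IsPrincipalBundle G p) {x y : E} (h : p x = p y) :
    ∃ g : G, y = g • x := by
  obtain ⟨e, he, hsmul⟩ := hp.locally_trivial (p x)
  refine ⟨(e y).2 * (e x).2⁻¹, ?_⟩
  have hy : p y ∈ e.baseSet := h ▸ he
  refine e.injOn (e.mem_source.2 hy) (e.mem_source.2 (by rwa [hp.proj_smul])) ?_
  rw [e.coe_coe, hsmul _ x he, inv_mul_cancel_right, h, e.mk_proj_snd' hy]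

theorem surjective (hp : IsPrincipalBundle G p) : Function.Surjective p := by
  intro b
  obtain ⟨e, he, -⟩ := hp.locally_trivial b
  obtain ⟨x, -, hx⟩ := e.proj_surjOn_baseSet he
  exact ⟨x, hx⟩

/-- The structure group of a principal bundle over a nonempty base has a continuous
multiplication. -/
theorem continuousMul [Nonempty B] (hp : IsPrincipalBundle G p) : ContinuousMul G := by
  obtain ⟨b⟩ := ‹Nonempty B›
  obtain ⟨e, he, hsmul⟩ := hp.locally_trivial b
  -- In the fibre over `b` the action is left multiplication, so the product g h is read off as the
  -- coordinate of `g • s h`.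
  let s (h : G) : E := e.toOpenPartialHomeomorph.symm (b, h)
  have hs : Continuous s := by
    exact e.toOpenPartialHomeomorph.symm.continuousOn.comp_continuous
      (continuous_const.prodMk continuous_id) fun h => e.mem_target.2 he
  have hps (h : G) : p (s h) = b := e.proj_symm_apply' he
  have hes (h : G) : e (s h) = (b, h) := e.apply_symm_apply' he
  have hc : Continuous fun q : G × G => e (q.1 • s q.2) := by
    have h1 : Continuous fun q : G × G => q.1 • s q.2 :=
      hp.continuous_smul.comp (continuous_fst.prodMk (hs.comp continuous_snd))
    refine e.continuousOn_toFun.comp_continuous h1 fun q => e.mem_source.2 ?_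
    rwa [hp.proj_smul, hps]
  refine ⟨hc.snd.congr fun q => ?_⟩
  rw [hsmul q.1 (s q.2) (by rwa [hps]), hes]

/-- Two maps to the total space with the same projection differ by a continuous map to the
structure group. -/
theorem exists_continuous_smul_eq [IsTopologicalGroup G] (hp : IsPrincipalBundle G p)
    {X : Type*} [TopologicalSpace X] {f f' : X → E} (hf : Continuous f) (hf' : Continuous f')
    (h : ∀ x, p (f x) = p (f' x)) : ∃ g : X → G, Continuous g ∧ ∀ x, f' x = g x • f x := by
  choose g hg using fun x => hp.exists_smul_eq (h x)
  refine ⟨g, ?_, hg⟩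
  rw [continuous_iff_continuousAt]
  intro x
  obtain ⟨e, he, hsmul⟩ := hp.locally_trivial (p (f x))
  have h1 : ContinuousAt (fun y => (e (f y)).2) x :=
    ((e.continuousAt (e.mem_source.2 he)).comp hf.continuousAt).snd
  have h2 : ContinuousAt (fun y => (e (f' y)).2) x :=
    ((e.continuousAt (e.mem_source.2 (h x ▸ he))).comp hf'.continuousAt).snd
  refine (h2.mul h1.inv).congr ?_
  filter_upwards [(hp.continuous_proj.comp hf).continuousAt (e.open_baseSet.mem_nhds he)] with y hy
  change (e (f' y)).2 * (e (f y)).2⁻¹ = g y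
  rw [hg y, hsmul _ _ hy, mul_inv_cancel_right]

/-- Lifts of a map on two adjacent slabs can be glued. -/
theorem exists_lift_slab_trans [IsTopologicalGroup G] (hp : IsPrincipalBundle G p)
    {X : Type*} [TopologicalSpace X] {h : X × ℝ → B} {S : Set X} {r : X → X} (hr : Continuous r)
    (hrS : ∀ x, r x ∈ S) (hrid : ∀ x ∈ S, r x = x) {a b c : ℝ} (hab : a ≤ b) (hbc : b ≤ c)
    (h1 : ∃ s : X × ℝ → E, Continuous s ∧ ∀ x ∈ S, ∀ t ∈ Set.Icc a b, p (s (x, t)) = h (x, t))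
    (h2 : ∃ s : X × ℝ → E, Continuous s ∧ ∀ x ∈ S, ∀ t ∈ Set.Icc b c, p (s (x, t)) = h (x, t)) :
    ∃ s : X × ℝ → E, Continuous s ∧ ∀ x ∈ S, ∀ t ∈ Set.Icc a c, p (s (x, t)) = h (x, t) := by
  obtain ⟨s, hs, hps⟩ := h1
  obtain ⟨s', hs', hps'⟩ := h2
  -- At the common height `b` the two lifts differ by `g`; acting by `g` on the second makes them
  -- agree there. Composing with the retraction `r` keeps all maps continuous on the whole of `X ×
  -- ℝ`.
  obtain ⟨g, hg, hgs⟩ := hp.exists_continuous_smul_eq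
    (f := fun x => s' (r x, b)) (f' := fun x => s (r x, b)) (by fun_prop) (by fun_prop)
    fun x => (hps' _ (hrS x) b ⟨le_rfl, hbc⟩).trans (hps _ (hrS x) b ⟨hab, le_rfl⟩).symm
  refine ⟨fun q => if q.2 ≤ b then s (r q.1, q.2) else g q.1 • s' (r q.1, q.2), ?_, ?_⟩
  · refine Continuous.if_le (by fun_prop) ?_ continuous_snd continuous_const fun q hq => ?_
    · exact hp.continuous_smul.comp
        ((hg.comp continuous_fst).prodMk (by fun_prop : Continuous fun q : X × ℝ => s' (r q.1, q.2)))
    · rw [hq]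
      exact hgs q.1
  · intro x hx t ht
    by_cases htb : t ≤ b
    · simpa [htb, hrid x hx] using hps x hx t ⟨ht.1, htb⟩
    · simpa [htb, hrid x hx, hp.proj_smul] using hps' x hx t ⟨(not_le.1 htb).le, ht.2⟩

/-- Finitely many slabs suffice because the thickness `δ` is the same at every height. -/
theorem exists_lift_slab [IsTopologicalGroup G] (hp : IsPrincipalBundle G p)
    {X : Type*} [TopologicalSpace X] {h : X × ℝ → B} {S : Set X} {r : X → X} (hr : Continuous r)
    (hrS : ∀ x, r x ∈ S) (hrid : ∀ x ∈ S, r x = x) {δ : ℝ} (hδ : 0 < δ)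
    (hloc : ∀ a : ℝ, ∃ s : X × ℝ → E, Continuous s ∧
      ∀ x ∈ S, ∀ t ∈ Set.Icc a (a + δ), p (s (x, t)) = h (x, t)) (c : ℝ) :
    ∃ s : X × ℝ → E, Continuous s ∧ ∀ x ∈ S, ∀ t ∈ Set.Icc 0 c, p (s (x, t)) = h (x, t) := by
  have key (n : ℕ) : ∃ s : X × ℝ → E, Continuous s ∧
      ∀ x ∈ S, ∀ t ∈ Set.Icc 0 ((n + 1 : ℕ) * δ), p (s (x, t)) = h (x, t) := by
    induction n with
    | zero => simpa using hloc 0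
    | succ n ih =>
      refine hp.exists_lift_slab_trans hr hrS hrid (by positivity) ?_ ih
        (c := ((n + 1 + 1 : ℕ) : ℝ) * δ) ?_
      · push_cast; nlinarith
      · have := hloc ((n + 1 : ℕ) * δ)
        rwa [show ((n + 1 : ℕ) : ℝ) * δ + δ = ((n + 1 + 1 : ℕ) : ℝ) * δ by push_cast; ring] at this
  obtain ⟨n, hn⟩ := exists_nat_gt (c / δ)
  obtain ⟨s, hs, hps⟩ := key n
  refine ⟨s, hs, fun x hx t ht => hps x hx t ⟨ht.1, ht.2.trans ?_⟩⟩
  rw [div_lt_iff₀ hδ] at hn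
  push_cast
  nlinarith

/-- Every map from a three-dimensional cube to the base of a principal bundle lifts to the
total space. -/
theorem exists_lift_cube [IsTopologicalGroup G] (hp : IsPrincipalBundle G p)
    (h : C(I × I × I, B)) : ∃ s : C(I × I × I, E), ∀ y, p (s y) = h y := by
  let cl : ℝ → I := Set.projIcc 0 1 zero_le_one
  have hcl : Continuous cl := continuous_projIcc
  have hcl_dist (a b : ℝ) : dist (cl a) (cl b) ≤ dist a b := by
    simpa using (LipschitzWith.projIcc zero_le_one).dist_le_mul a b
  have hcl_coe (t : I) : cl t = t := Set.projIcc_val _ t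
  let k (a b c : ℝ) : B := h (cl a, cl b, cl c)
  choose e he hsmul using hp.locally_trivial
  obtain ⟨δ, hδ, hleb⟩ := lebesgue_number_lemma_of_metric (c := fun b => h ⁻¹' (e b).baseSet)
    isCompact_univ (fun b => (e b).open_baseSet.preimage h.continuous)
    (fun y _ => Set.mem_iUnion.2 ⟨h y, he _⟩)
  have hδ2 : 0 < δ / 2 := by positivity
  -- By the choice of the Lebesgue number, a cube of side δ/2 lands in a single trivializing set,
  -- where the unit section provides the lift; clamping the coordinates extends it to all of space.
  have base (a b c : ℝ) : ∃ s : (ℝ × ℝ) × ℝ → E, Continuous s ∧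
      ∀ q ∈ Set.Icc a (a + δ / 2) ×ˢ Set.Icc b (b + δ / 2), ∀ t ∈ Set.Icc c (c + δ / 2),
        p (s (q, t)) = k q.1 q.2 t := by
    obtain ⟨i, hi⟩ := hleb (cl a, cl b, cl c) trivial
    let l (z t : ℝ) : ℝ := max z (min t (z + δ / 2))
    have hl_mem (z t : ℝ) : dist (l z t) z < δ := by
      have h1 : z ≤ l z t := le_max_left _ _
      have h2 : l z t ≤ z + δ / 2 := max_le (by linarith) (min_le_right _ _)
      rw [Real.dist_eq, abs_of_nonneg (by linarith)]
      linarith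
    have hl_id (z t : ℝ) (ht : t ∈ Set.Icc z (z + δ / 2)) : l z t = t := by
      simp [l, ht.1, ht.2]
    have hmem (q : (ℝ × ℝ) × ℝ) : k (l a q.1.1) (l b q.1.2) (l c q.2) ∈ (e i).baseSet := by
      refine hi (Metric.mem_ball.2 ?_)
      simp only [Prod.dist_eq, max_lt_iff]
      exact ⟨(hcl_dist _ _).trans_lt (hl_mem _ _), (hcl_dist _ _).trans_lt (hl_mem _ _),
        (hcl_dist _ _).trans_lt (hl_mem _ _)⟩
    refine ⟨fun q => (e i).toOpenPartialHomeomorph.symm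
      (k (l a q.1.1) (l b q.1.2) (l c q.2), 1), ?_, ?_⟩
    · refine (e i).continuousOn_symm_prodMk_left.comp_continuous ?_ hmem
      have := h.continuous
      fun_prop
    · rintro q ⟨hq1, hq2⟩ t ht
      refine ((e i).proj_symm_apply' (hmem (q, t))).trans ?_
      simp only [hl_id _ _ hq1, hl_id _ _ hq2, hl_id _ _ ht]
  have hclR : Continuous fun t => (cl t : ℝ) := by fun_prop
  have hclmem (t : ℝ) : (cl t : ℝ) ∈ Set.Icc (0 : ℝ) 1 := (cl t).2
  have hclid (t : ℝ) (ht : t ∈ Set.Icc (0 : ℝ) 1) : (cl t : ℝ) = t :=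
    congrArg Subtype.val (Set.projIcc_of_mem zero_le_one ht)
  let l (z t : ℝ) : ℝ := max z (min t (z + δ / 2))
  have hl (z : ℝ) : Continuous (l z) := by fun_prop
  have hl_mem (z t : ℝ) : l z t ∈ Set.Icc z (z + δ / 2) :=
    ⟨le_max_left _ _, max_le (by linarith) (min_le_right _ _)⟩
  have hl_id (z t : ℝ) (ht : t ∈ Set.Icc z (z + δ / 2)) : l z t = t := by
    simp [l, ht.1, ht.2]
  -- Small cubes are glued into columns, columns into plates, and plates into the full cube; each
  -- pass permutes the coordinates so that the glued one comes last.
  have lift_third (a b : ℝ) := hp.exists_lift_slab (h := fun q : (ℝ × ℝ) × ℝ => k q.1.1 q.1.2 q.2)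
    (S := Set.Icc a (a + δ / 2) ×ˢ Set.Icc b (b + δ / 2)) (r := fun q => (l a q.1, l b q.2))
    (by fun_prop) (fun q => ⟨hl_mem a _, hl_mem b _⟩)
    (fun q hq => Prod.ext (hl_id _ _ hq.1) (hl_id _ _ hq.2)) hδ2 (base a b) 1
  have lift_second (a : ℝ) := hp.exists_lift_slab (h := fun q : (ℝ × ℝ) × ℝ => k q.1.1 q.2 q.1.2)
    (S := Set.Icc a (a + δ / 2) ×ˢ Set.Icc 0 1) (r := fun q => (l a q.1, (cl q.2 : ℝ)))
    (by fun_prop) (fun q => ⟨hl_mem a _, hclmem _⟩)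
    (fun q hq => Prod.ext (hl_id _ _ hq.1) (hclid _ hq.2)) hδ2 (fun b => by
      obtain ⟨s, hs, hps⟩ := lift_third a b
      exact ⟨fun q => s ((q.1.1, q.2), q.1.2), by fun_prop,
        fun x hx t ht => hps (x.1, t) ⟨hx.1, ht⟩ x.2 hx.2⟩) 1
  obtain ⟨s, hs, hps⟩ := hp.exists_lift_slab (h := fun q : (ℝ × ℝ) × ℝ => k q.2 q.1.1 q.1.2)
    (S := Set.Icc 0 1 ×ˢ Set.Icc 0 1) (r := fun q => ((cl q.1 : ℝ), (cl q.2 : ℝ)))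
    (by fun_prop) (fun q => ⟨hclmem _, hclmem _⟩)
    (fun q hq => Prod.ext (hclid _ hq.1) (hclid _ hq.2)) hδ2 (fun a => by
      obtain ⟨s, hs, hps⟩ := lift_second a
      exact ⟨fun q => s ((q.2, q.1.2), q.1.1), by fun_prop,
        fun x hx t ht => hps (t, x.2) ⟨ht, hx.2⟩ x.1 hx.1⟩) 1
  refine ⟨⟨fun y => s (((y.2.1 : ℝ), (y.2.2 : ℝ)), (y.1 : ℝ)), by fun_prop⟩, fun y => ?_⟩
  refine (hps _ ⟨y.2.1.2, y.2.2.2⟩ _ y.1.2).trans ?_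
  simp only [k, hcl_coe]

end IsPrincipalBundle

/-! ### Winding numbers and the boundary of the square -/

section Winding

theorem exists_circleExp_lift_square {f : I × I → Circle} (hf : Continuous f) :
    ∃ θ : I × I → ℝ, Continuous θ ∧ ∀ y, Circle.exp (θ y) = f y := by
  obtain ⟨x, hx⟩ := Circle.isAddQuotientCoveringMap_exp.surjective (f (0, 0))
  have : ContractibleSpace I := (convex_Icc (0 : ℝ) 1).contractibleSpace ⟨0, by simp⟩
  have : LocallyPathConnectedSpace I := (convex_Icc (0 : ℝ) 1).locallyPathConnectedSpace
  obtain ⟨F, ⟨-, hF⟩, -⟩ := Circle.isCoveringMap_exp.existsUnique_continuousMap_lifts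
    ⟨f, hf⟩ (0, 0) x hx
  exact ⟨F, F.continuous, fun y => congrFun hF y⟩

/-- Both `f` and a constant lift the constant map 1 through the covering `Circle.exp`, and lifts on
a connected space that agree at one point coincide. -/
theorem eq_of_circleExp_eq_one {f : I → ℝ} (hf : Continuous f) (h : ∀ t, Circle.exp (f t) = 1)
    (a b : I) : f a = f b := by
  have := Circle.isCoveringMap_exp.eq_of_comp_eq hf (continuous_const (y := f b))
    (by ext t; simp [h]) b rfl
  exact congrFun this a

/-- The boundary of the unit square as a loop based at the corner `(0, 0)`. -/
def squareLoop (t : I) : I × I :=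
  (Set.projIcc 0 1 zero_le_one (min (4 * (t : ℝ) - 1) (4 - 4 * t)),
    Set.projIcc 0 1 zero_le_one (min (4 * (t : ℝ)) (3 - 4 * t)))

theorem continuous_squareLoop : Continuous squareLoop :=
  (continuous_projIcc.comp (by fun_prop)).prodMk (continuous_projIcc.comp (by fun_prop))

theorem squareLoop_one : squareLoop 1 = squareLoop 0 := by
  ext <;> simp [squareLoop, Set.coe_projIcc]; norm_num

/-- This separates the edge where the bounding square follows γ from the three edges where it is
constant; on these the clamped parameter has already reached 1. -/
theorem squareLoop_cases (t : I) :
    (squareLoop t).1 = 0 ∧ (squareLoop t).2 = Set.projIcc 0 1 zero_le_one (4 * (t : ℝ)) ∨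
    ((squareLoop t).2 = 1 ∨ (squareLoop t).1 = 1 ∨ (squareLoop t).2 = 0) ∧
      Set.projIcc 0 1 zero_le_one (4 * (t : ℝ)) = (1 : I) := by
  have h0 := t.2.1
  have h1 := t.2.2
  rcases le_total (4 * (t : ℝ)) 1 with h | h
  · refine Or.inl ⟨Set.projIcc_of_le_left zero_le_one (min_le_of_left_le (by linarith)), ?_⟩
    simp only [squareLoop]
    rw [min_eq_left (by linarith)]
  · refine Or.inr ⟨?_, Set.projIcc_of_right_le _ h⟩
    rcases le_total (4 * (t : ℝ)) 2 with h | h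
    · exact Or.inl (Set.projIcc_of_right_le zero_le_one (le_min (by linarith) (by linarith)))
    rcases le_total (4 * (t : ℝ)) 3 with h | h
    · exact Or.inr (Or.inl (Set.projIcc_of_right_le zero_le_one (le_min (by linarith) (by linarith))))
    · exact Or.inr (Or.inr (Set.projIcc_of_le_left zero_le_one (min_le_of_right_le (by linarith))))

end Winding

/-- Let `γ` be a loop in the structure group whose image under a character has winding number one.
If the loop `γ • x` bounds a square `D` in the total space, then the sphere `p ∘ D` in the base
is not null-homotopic, not even through spheres with moving base point. -/
theorem IsPrincipalBundle.not_nullhomotopic_of_winding {G E B : Type*} [Group G]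
    [TopologicalSpace G] [IsTopologicalGroup G] [TopologicalSpace E] [TopologicalSpace B]
    [MulAction G E] {p : E → B} (hp : IsPrincipalBundle G p) (χ : G →* Circle)
    (hχ : Continuous χ) {γ : I → G} (hγ : ∀ t, χ (γ t) = Circle.exp (2 * Real.pi * t)) {x : E}
    {D : I × I → E} (hD : Continuous D) (hD0 : ∀ t, D (0, t) = γ t • x)
    (hD1 : ∀ t, D (1, t) = x) (hDl : ∀ s, D (s, 0) = x) (hDr : ∀ s, D (s, 1) = x)
    (K : C(I × I × I, B)) (hK0 : ∀ y, K (0, y) = p (D y)) (hK1 : ∀ y, K (1, y) = K (1, 0, 0))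
    (hKb : ∀ r, ∀ y : I × I, (y.1 = 0 ∨ y.1 = 1 ∨ y.2 = 0 ∨ y.2 = 1) →
      K (r, y) = K (r, 0, 0)) : False := by
  obtain ⟨L, hL⟩ := hp.exists_lift_cube K
  have hβ := continuous_squareLoop
  set β := squareLoop
  let τ (t : I) : I := Set.projIcc 0 1 zero_le_one (4 * (t : ℝ))
  have hτ : Continuous τ := continuous_projIcc.comp (by fun_prop)
  have hτ0 : τ 0 = 0 := by simp [τ]
  have hτ1 : τ 1 = 1 := Set.projIcc_of_right_le _ (by norm_num)
  have hγ1 : γ 1 • x = x := by rw [← hD0, hDr]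
  have hβb (r t : I) : K (r, β t) = K (r, 0, 0) := by
    refine hKb r _ ?_
    rcases squareLoop_cases t with h | ⟨h | h | h, -⟩ <;> tauto
  have hDβ (t : I) : D (β t) = γ (τ t) • x := by
    rcases squareLoop_cases t with ⟨h1, h2⟩ | ⟨h, h2⟩
    · rw [show β t = (0, τ t) from Prod.ext h1 h2, hD0]
    · rw [show τ t = 1 from h2, hγ1]
      rcases h with h | h | h
      · rw [show β t = ((β t).1, 1) from Prod.ext rfl h, hDr]
      · rw [show β t = (1, (β t).2) from Prod.ext h rfl, hD1]
      · rw [show β t = ((β t).1, 0) from Prod.ext rfl h, hDl]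
  -- Three comparisons: `g₀` between the lift and `D` on the face r = 0, `g₁` along the boundary
  -- loop at each r, `g₂` over the face r = 1. The last two exist because there the lift stays in
  -- one fibre for each r.
  obtain ⟨g₀, hg₀, hgD⟩ := hp.exists_continuous_smul_eq (f := D) (f' := fun y => L (0, y)) hD
    (by fun_prop) (fun y => by rw [hL, hK0])
  obtain ⟨g₁, hg₁, hgs⟩ := hp.exists_continuous_smul_eq
    (f := fun q : I × I => L (q.1, β 0)) (f' := fun q => L (q.1, β q.2)) (by fun_prop)
    (by fun_prop) (fun q => by rw [hL, hL, hβb, hβb])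
  obtain ⟨g₂, hg₂, hgt⟩ := hp.exists_continuous_smul_eq
    (f := fun _ : I × I => L (1, β 0)) (f' := fun y => L (1, y)) (by fun_prop)
    (by fun_prop) (fun y => by rw [hL, hL, hK1, hK1 y])
  have e1 (t : I) : g₁ (1, t) = g₂ (β t) :=
    hp.eq_of_smul_eq ((hgs (1, t)).symm.trans (hgt (β t)))
  have e2 (r : I) : g₁ (r, 0) = 1 :=
    hp.eq_of_smul_eq ((hgs (r, 0)).symm.trans (one_smul G _).symm)
  have e3 (r : I) : g₁ (r, 1) = 1 := by
    refine hp.eq_of_smul_eq ((hgs (r, 1)).symm.trans ?_)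
    rw [one_smul]
    exact congrArg (fun z => L (r, z)) squareLoop_one
  have e4 (t : I) : g₁ (0, t) * (g₀ (β 0) * γ 0) = g₀ (β t) * γ (τ t) := by
    refine hp.eq_of_smul_eq (x := x) ?_
    have h1 := hgs (0, t)
    simp only [hgD, hDβ, hτ0] at h1
    simp only [mul_smul, h1]
  obtain ⟨θ₀, hθ₀, h₀⟩ := exists_circleExp_lift_square (hχ.comp hg₀)
  obtain ⟨θ₁, hθ₁, h₁⟩ := exists_circleExp_lift_square (hχ.comp hg₁)
  obtain ⟨θ₂, hθ₂, h₂⟩ := exists_circleExp_lift_square (hχ.comp hg₂)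
  simp only [Function.comp_apply] at h₀ h₁ h₂
  -- The angle increment of `g₁` along the loop is 0 at r = 1, since `g₂` extends over the square;
  -- it does not depend on r, since `g₁ (r, ·)` is closed; and at r = 0 it is 2π, since `g₀` extends
  -- over the square while γ turns once.
  have i1 := eq_of_circleExp_eq_one (f := fun t => θ₁ (1, t) - θ₂ (β t)) (by fun_prop)
    (fun t => by rw [Circle.exp_sub, h₁, h₂, e1, div_self']) 1 0
  have i2 := eq_of_circleExp_eq_one (f := fun r => θ₁ (r, 1) - θ₁ (r, 0)) (by fun_prop)
    (fun r => by rw [Circle.exp_sub, h₁, h₁, e2, e3, div_self']) 0 1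
  have i3 := eq_of_circleExp_eq_one
    (f := fun t => θ₁ (0, t) + (θ₀ (β 0) + 2 * Real.pi * (0 : I)) -
      (θ₀ (β t) + 2 * Real.pi * τ t)) (by fun_prop)
    (fun t => by
      rw [Circle.exp_sub, Circle.exp_add, Circle.exp_add, Circle.exp_add, h₁, h₀, h₀, ← hγ,
        ← hγ, ← map_mul, ← map_mul, ← map_mul, e4, div_self']) 1 0
  simp only [show β 1 = β 0 from squareLoop_one, hτ0, hτ1, Set.Icc.coe_zero,
    Set.Icc.coe_one] at i1 i2 i3
  have := Real.pi_pos
  linarith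

/-! ### The determinant and the fundamental loop of U(∞) -/

namespace UnitaryLimit

theorem det_stab {n m : ℕ} (h : n ≤ m) (A : Matrix (Fin n) (Fin n) ℂ) : (stab m A).det = A.det := by
  obtain ⟨k, rfl⟩ := Nat.exists_eq_add_of_le h
  have h1 (x : Fin k) (a : Fin n) : ¬ n + (x : ℕ) = a := by omega
  have h2 (x : Fin k) (a : Fin n) : ¬ (a : ℕ) = n + x := by omega
  have : stab (n + k) A = Matrix.reindex finSumFinEquiv finSumFinEquiv
      (Matrix.fromBlocks A 0 0 (1 : Matrix (Fin k) (Fin k) ℂ)) := by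
    ext i j
    refine Fin.addCases (fun a => ?_) (fun a => ?_) i <;>
    refine Fin.addCases (fun b => ?_) (fun b => ?_) j <;>
    simp [stab, pad, Matrix.one_apply, Fin.ext_iff, h1, h2]
  rw [this, Matrix.det_reindex_self, Matrix.det_fromBlocks_zero₂₁, Matrix.det_one, mul_one]

/-- The determinant of a unitary matrix. -/
def unitaryDet (n : ℕ) : Matrix.unitaryGroup (Fin n) ℂ →* Circle where
  toFun A := ⟨A.1.det, by
    exact mem_sphere_zero_iff_norm.2 <| CStarRing.norm_of_mem_unitary (Matrix.det_of_mem_unitary A.2)⟩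
  map_one' := Subtype.ext Matrix.det_one
  map_mul' A B := Subtype.ext (Matrix.det_mul A.1 B.1)

theorem continuous_unitaryDet (n : ℕ) : Continuous (unitaryDet n) :=
  (Continuous.matrix_det continuous_subtype_val).subtype_mk _

/-- A complex number of modulus one as a unitary matrix of size one. -/
def ofCircle (z : Circle) : Matrix.unitaryGroup (Fin 1) ℂ :=
  ⟨Matrix.diagonal fun _ => (z : ℂ), by
    rw [Matrix.mem_unitaryGroup_iff, Matrix.star_eq_conjTranspose,
      Matrix.diagonal_conjTranspose, Matrix.diagonal_mul_diagonal, ← Matrix.diagonal_one]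
    congr 1
    funext i
    simp [Complex.mul_conj]⟩

theorem continuous_ofCircle : Continuous ofCircle :=
  Continuous.subtype_mk (Continuous.matrix_diagonal
    (continuous_pi fun _ => continuous_subtype_val)) _

theorem unitaryDet_ofCircle (z : Circle) : unitaryDet 1 (ofCircle z) = z :=
  Subtype.ext (by
    change (Matrix.diagonal fun _ : Fin 1 => (z : ℂ)).det = z
    simp)

end UnitaryLimit

namespace InfiniteUnitaryGroup

open UnitaryLimit

theorem continuous_of (n : ℕ) : Continuous (of n) :=
  continuous_iSup_rng (i := n) continuous_coinduced_rng

theorem continuous_dom {Y : Type*} [TopologicalSpace Y] {f : InfiniteUnitaryGroup → Y}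
    (hf : ∀ n, Continuous (f ∘ of n)) : Continuous f :=
  continuous_iSup_dom.2 fun n => continuous_coinduced_dom.2 (hf n)

instance : ContinuousInv InfiniteUnitaryGroup where
  continuous_inv := continuous_dom fun n => (continuous_of n).comp continuous_inv

theorem unitaryDet_incl {n m : ℕ} (h : n ≤ m) (A : Matrix.unitaryGroup (Fin n) ℂ) :
    unitaryDet m (incl n m h A) = unitaryDet n A :=
  Subtype.ext (det_stab h A.1)

/-- The determinant on the infinite unitary group. -/
def det : InfiniteUnitaryGroup →* Circle where
  toFun := DirectLimit.lift incl (fun n => unitaryDet n) fun _ _ h A => (unitaryDet_incl h A).symm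
  map_one' := DirectLimit.lift_one unitaryDet _
  map_mul' := DirectLimit.lift_mul unitaryDet _

theorem det_of (n : ℕ) (A : Matrix.unitaryGroup (Fin n) ℂ) : det (of n A) = unitaryDet n A := rfl

theorem continuous_det : Continuous det :=
  continuous_dom continuous_unitaryDet

/-- The loop of the diagonal matrices `exp (2 π i t) ⊕ 1`. -/
def fundamentalLoop (t : I) : InfiniteUnitaryGroup :=
  of 1 (ofCircle (Circle.exp (2 * Real.pi * t)))

theorem continuous_fundamentalLoop : Continuous fundamentalLoop :=
  (continuous_of 1).comp (continuous_ofCircle.comp (by fun_prop))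

theorem det_fundamentalLoop (t : I) :
    det (fundamentalLoop t) = Circle.exp (2 * Real.pi * t) := by
  rw [fundamentalLoop, det_of, unitaryDet_ofCircle]

theorem fundamentalLoop_zero : fundamentalLoop 0 = 1 := by
  have : ofCircle 1 = 1 := Subtype.ext (by simp [ofCircle])
  rw [fundamentalLoop, Set.Icc.coe_zero, mul_zero, Circle.exp_zero, this]
  exact (DirectLimit.one_def 1).symm

theorem fundamentalLoop_one : fundamentalLoop 1 = 1 := by
  rw [← fundamentalLoop_zero, fundamentalLoop, fundamentalLoop, Set.Icc.coe_one, mul_one,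
    Circle.exp_two_pi, Set.Icc.coe_zero, mul_zero, Circle.exp_zero]

end InfiniteUnitaryGroup

theorem GenLoop.homotopic_of_subsingleton {N X : Type*} [TopologicalSpace X] {x : X}
    [Subsingleton (HomotopyGroup N X x)] (f g : GenLoop N X x) : GenLoop.Homotopic f g :=
  Quotient.exact (Subsingleton.elim (α := HomotopyGroup N X x) ⟦f⟧ ⟦g⟧)

/-! ### Nonvanishing of π₂ for classifying spaces of U(∞) -/

section ClassifyingSpace

variable {B : Type v} [TopologicalSpace B]

/-- In a classifying space of the infinite unitary group there is at every point a spherical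
square which cannot be contracted, even if the base point is allowed to move. -/
theorem IsClassifyingSpace.exists_essential_square
    (hB : IsClassifyingSpace.{0, v, w} InfiniteUnitaryGroup B) (b : B) :
    ∃ q : GenLoop (Fin 2) B b, ∀ K : C(I × (Fin 2 → I), B), (∀ y, K (0, y) = q y) →
      (∀ y, K (1, y) = K (1, 0)) →
      (∀ r, ∀ y ∈ Cube.boundary (Fin 2), K (r, y) = K (r, 0)) → False := by
  obtain ⟨E, _, _, p, hp, -, hE⟩ := hB
  have : Nonempty B := ⟨b⟩
  -- Joint continuity of multiplication in the inductive limit topology is inferred from the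
  -- existence of the bundle.
  have := hp.continuousMul
  have : IsTopologicalGroup InfiniteUnitaryGroup := {}
  obtain ⟨x, rfl⟩ := hp.surjective b
  have := hE 1 x
  let γ := InfiniteUnitaryGroup.fundamentalLoop
  have hγx : Continuous fun t => γ t • x := hp.continuous_smul.comp
    (InfiniteUnitaryGroup.continuous_fundamentalLoop.prodMk continuous_const)
  have hγ0 : γ 0 • x = x := by
    rw [show γ 0 = 1 from InfiniteUnitaryGroup.fundamentalLoop_zero, one_smul]
  have hγ1 : γ 1 • x = x := by
    rw [show γ 1 = 1 from InfiniteUnitaryGroup.fundamentalLoop_one, one_smul]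
  let f : GenLoop (Fin 1) E x := ⟨⟨fun y => γ (y 0) • x, hγx.comp (continuous_apply 0)⟩, by
    rintro y ⟨i, hi⟩
    obtain rfl := Subsingleton.elim i 0
    rcases hi with hi | hi <;> simp [hi, hγ0, hγ1]⟩
  obtain ⟨F⟩ := GenLoop.homotopic_of_subsingleton f GenLoop.const
  have hFb (s : I) (t : I) (ht : t = 0 ∨ t = 1) : F (s, fun _ => t) = x := by
    have hb : (fun _ => t) ∈ Cube.boundary (Fin 1) := ⟨0, ht⟩
    exact (F.eq_fst s hb).trans (f.2 _ hb)
  let D (y : I × I) : E := F (y.1, fun _ => y.2)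
  have hD : Continuous D := by fun_prop
  have hD0 (t : I) : D (0, t) = γ t • x := F.apply_zero _
  have hD1 (t : I) : D (1, t) = x := F.apply_one _
  have hDl (s : I) : D (s, 0) = x := hFb s 0 (Or.inl rfl)
  have hDr (s : I) : D (s, 1) = x := hFb s 1 (Or.inr rfl)
  have hq : Continuous fun y : Fin 2 → I => p (D (y 0, y 1)) := by
    have := hp.continuous_proj
    fun_prop
  refine ⟨⟨⟨_, hq⟩, ?_⟩, fun K hK0 hK1 hKb => ?_⟩
  · rintro y ⟨i, hi⟩
    fin_cases i <;> rcases hi with hi | hi <;> simp at hi <;>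
      simp [hi, hD0, hD1, hDl, hDr, hp.proj_smul]
  · let v (y : I × I) : Fin 2 → I := ![y.1, y.2]
    have hv : Continuous v := by
      refine continuous_pi fun i => ?_
      fin_cases i
      exacts [continuous_fst, continuous_snd]
    have hv0 : v (0, 0) = 0 := by
      funext i
      fin_cases i <;> rfl
    refine hp.not_nullhomotopic_of_winding InfiniteUnitaryGroup.det
      InfiniteUnitaryGroup.continuous_det InfiniteUnitaryGroup.det_fundamentalLoop hD hD0 hD1 hDl
      hDr (K.comp ⟨fun y => (y.1, v y.2), by fun_prop⟩) (fun y => hK0 _) (fun y => ?_)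
      fun r y hy => ?_
    · simpa [hv0] using hK1 (v y)
    · have hb : v y ∈ Cube.boundary (Fin 2) := by
        rcases hy with h | h | h | h
        exacts [⟨0, Or.inl h⟩, ⟨0, Or.inr h⟩, ⟨1, Or.inl h⟩, ⟨1, Or.inr h⟩]
      simpa [hv0] using hKb r (v y) hb

theorem IsClassifyingSpace.not_subsingleton_pi_two
    (hB : IsClassifyingSpace.{0, v, w} InfiniteUnitaryGroup B) (b : B) :
    ¬ Subsingleton (π_ 2 B b) := by
  intro h
  obtain ⟨q, hq⟩ := hB.exists_essential_square b
  obtain ⟨F⟩ := GenLoop.homotopic_of_subsingleton q GenLoop.const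
  have h0 : (0 : Fin 2 → I) ∈ Cube.boundary (Fin 2) := ⟨0, Or.inl rfl⟩
  have hFb (r : I) (y) (hy : y ∈ Cube.boundary (Fin 2)) : F (r, y) = b :=
    (F.eq_fst r hy).trans (q.2 _ hy)
  refine hq F.toContinuousMap (fun y => F.apply_zero y) (fun y => ?_) fun r y hy => ?_
  · exact (F.apply_one y).trans (F.apply_one 0).symm
  · exact (hFb r y hy).trans (hFb r 0 h0).symm

theorem IsClassifyingSpace.nonempty
    (hB : IsClassifyingSpace.{0, v, w} InfiniteUnitaryGroup B) : Nonempty B := by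
  obtain ⟨E, _, _, p, -, ⟨x⟩, -⟩ := hB
  exact ⟨p x⟩

end ClassifyingSpace

end

theorem corollary4p3 (H : Type u) [NormedAddCommGroup H] [InnerProductSpace ℂ H]
    [CompleteSpace H] [TopologicalSpace.SeparableSpace H]
    (hH : ¬ FiniteDimensional ℂ H) :
    ContractibleSpace (WeakGrassmannian H) ∧
    ∀ (B : Type v) [TopologicalSpace B],
      IsClassifyingSpace.{0, v, w} InfiniteUnitaryGroup B →
        ¬ ContractibleSpace B ∧
        IsEmpty (ContinuousMap.HomotopyEquiv (WeakGrassmannian H) B) ∧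
        (∀ f : C(WeakGrassmannian H, B), ¬ IsWeakHomotopyEquiv f) ∧
        (∀ f : C(B, WeakGrassmannian H), ¬ IsWeakHomotopyEquiv f) := by
  have hX := contractibleSpace_weakGrassmannian H hH
  refine ⟨hX, fun B _ hB => ?_⟩
  obtain ⟨b⟩ := hB.nonempty
  have hnc : ¬ ContractibleSpace B := fun _ =>
    hB.not_subsingleton_pi_two b (subsingleton_pi_two_of_contractibleSpace B b)
  refine ⟨hnc, ⟨fun e => hnc e.symm.contractibleSpace⟩, fun f hf => ?_, fun f hf => ?_⟩
  · obtain ⟨x⟩ := hf.1 ⟨b⟩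
    have := subsingleton_pi_two_of_contractibleSpace (WeakGrassmannian H) x
    exact hB.not_subsingleton_pi_two (f x) (hf.2 2 x).2.subsingleton
  · have := subsingleton_pi_two_of_contractibleSpace (WeakGrassmannian H) (f b)
    exact hB.not_subsingleton_pi_two b (hf.2 2 b).1.subsingleton
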